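/- Let $\Lambda_\oplus$ be the set of terms $M,N ::= x \mid \lambda x.M \mid MN \mid M\oplus N$ (up to renaming of bound variables), with the call-by-name semantics: a value is a closed abstraction, and for $M$ closed, $[\![M]\!]$ is the least upper bound of the finitely supported value subdistributions $\mathscr D$ with $M\Downarrow\mathscr D$, where $M\Downarrow\emptyset$; $V\Downarrow\{V\}$; $MN\Downarrow\sum_{\lambda x.P\in\mathrm{supp}\,\mathscr D}\mathscr D(\lambda x.P)\cdot\mathscr E_{P}$ if $M\Downarrow\mathscr D$ and $P\{N/x\}\Downarrow\mathscr E_{P}$ for all $\lambda x.P\in\mathrm{supp}\,\mathscr D$; $M\oplus N\Downarrow\frac12\mathscr D+\frac12\mathscr E$ if $M\Downarrow\mathscr D$ and $N\Downarrow\mathscr E$. A formal sum $\sum_{i\in I}\langle M_i;p_i\rangle$ is a family of closed $\Lambda_\oplus$-terms indexed by a countable set $I$, with weights $p_i\ge 0$ and $\sum_i p_i\le 1$. It is a formally summed value ($Z,Y$) if every $M_i$ is an abstraction; then $\mathrm{prob}(Z)=\sum_i p_i$ and, for $Z=\sum_i\langle\lambda x.M_i;p_i\rangle$, $Z\bullet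 N=\sum_i\langle M_i\{N/x\};p_i\rangle$. The closed terms of $\Lambda^{\rm FS}_\oplus$ are $E,F ::= EM \mid \sum_{i\in I}\langle M_i;p_i\rangle \mid M\oplus N\mid\lambda x.M$ with $M,N$ ranging over $\Lambda_\oplus$ (all terms closed). Their reduction $\leadsto$ is given by: $M\oplus N\leadsto\langle M;\frac12\rangle+\langle N;\frac12\rangle$; $\lambda x.M\leadsto\langle\lambda x.M;1\rangle$; $\sum_i\langle M_i;p_i\rangle\leadsto\sum_{(i,V)}\langle V;[\![M_i]\!](V)\cdot p_i\rangle$ if some $M_i$ is not a value; $ZM\leadsto Z\bullet M$; and $EM\leadsto FM$ if $E\leadsto F$. Let $\leadsto^*$ be its reflexive and transitive closure. A coupled relation $\mathcal R=(\mathcal R_1,\mathcal R_2)$ consists of a relation $\mathcal R_1$ on closed $\Lambda_\oplus$-terms and a relation $\mathcal R_2\supseteq\mathcal R_1$ on closed $\Lambda^{\rm FS}_\oplus$-terms. $\mathcal R_1^\star$ is the set of pairs of closed terms $(C[\widetilde M],C[\widetilde N])$ with $C$ a multi-hole $\Lambda_\oplus$-context and $\widetilde M\mathrel{\mathcal R_1}\widetilde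 N$ componentwise. $\mathcal R$ is a coupled logical bisimulation if $E\mathrel{\mathcal R_2}F$ implies: (1) if $E\leadsto D$ then $F\leadsto^* G$ for some $G$ with $D\mathrel{\mathcal R_2}G$; (2) if $E$ is a formally summed value, then $F\leadsto^* Y$ for some formally summed value $Y$ with $\mathrm{prob}(E)=\mathrm{prob}(Y)$ and $(E\bullet M)\mathrel{\mathcal R_2}(Y\bullet N)$ for all $M\mathrel{\mathcal R_1^\star}N$; (3) the converses of (1) and (2). Let $\approx_1$ (resp. $\approx_2$) be the union of the first (resp. second) components of all coupled logical bisimulations; $\approx_1$ is extended to open terms by $M\approx_1 N$ iff $M\sigma\approx_1 N\sigma$ for every closing substitution $\sigma$. Corollary. (1) If $M\approx_1 N$, then $C[M]\approx_1 C[N]$ for every single-hole $\Lambda_\oplus$-context $C$. This holds for closed $M,N$ and contexts $C$ with $C[M], C[N]$ closed, and, for the extension of $\approx_1$ to open terms, for all $M,N$ and all $C$ (which may capture variables of $M,N$). (2) For closed $\Lambda^{\rm FS}_\oplus$-terms $E,F$: if $E\approx_2 F$, then $C[E]\approx_2 C[F]$ for every evaluation context $C=[\cdot]M_1\cdots M_k$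 ($k\ge 0$, $M_1,\dots,M_k$ closed $\Lambda_\oplus$-terms). -/

import Mathlib

open scoped NNReal ENNReal

namespace CoupledLB

/-- Terms of the probabilistic lambda-calculus `Λ⊕` with free variables among `n` given ones, modulo
renaming of bound variables (well-scoped de Bruijn representation). `Tm 0` is the set of closed
terms. -/
inductive Tm : ℕ → Type
  | var {n : ℕ} (i : Fin n) : Tm n
  | lam {n : ℕ} (M : Tm (n + 1)) : Tm n
  | app {n : ℕ} (M N : Tm n) : Tm n
  | choice {n : ℕ} (M N : Tm n) : Tm n

namespace Tm

/-- Renaming of the free variables. -/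
def rename : {m n : ℕ} → (Fin m → Fin n) → Tm m → Tm n
  | _, _, ρ, var i => var (ρ i)
  | _, _, ρ, lam M => lam (rename (Fin.cases 0 (fun i => (ρ i).succ)) M)
  | _, _, ρ, app M N => app (rename ρ M) (rename ρ N)
  | _, _, ρ, choice M N => choice (rename ρ M) (rename ρ N)

/-- Simultaneous capture-avoiding substitution. -/
def subst : {m n : ℕ} → (Fin m → Tm n) → Tm m → Tm n
  | _, _, σ, var i => σ i
  | _, _, σ, lam M => lam (subst (Fin.cases (var 0) (fun i => rename Fin.succ (σ i))) M)
  | _, _, σ, app M N => app (subst σ M) (subst σ N)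
  | _, _, σ, choice M N => choice (subst σ M) (subst σ N)

/-- A closed term, seen as a term over any number of variables. -/
def weaken {n : ℕ} (M : Tm 0) : Tm n := rename Fin.elim0 M

/-- `P.inst N` is `P{N/x}`, where `x` is the only free variable of `P` and `N` is closed. -/
def inst (P : Tm 1) (N : Tm 0) : Tm 0 := subst (fun _ => N) P

/-- An injective numbering of terms. -/
def code : {n : ℕ} → Tm n → ℕ
  | _, var i => Nat.pair 0 i
  | _, lam M => Nat.pair 1 (code M)
  | _, app M N => Nat.pair 2 (Nat.pair (code M) (code N))
  | _, choice M N => Nat.pair 3 (Nat.pair (code M) (code N))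

theorem code_injective {n : ℕ} : Function.Injective (code (n := n)) := by
  intro M
  induction M with
  | var i =>
    intro N h
    cases N <;> simp only [code, Nat.pair_eq_pair] at h <;> simp_all [Fin.ext_iff]
  | lam M ih =>
    intro N h
    cases N <;> simp only [code, Nat.pair_eq_pair] at h
    case lam N => rw [ih h.2]
    all_goals simp at h
  | app M M' ih ih' =>
    intro N h
    cases N <;> simp only [code, Nat.pair_eq_pair] at h
    case app N N' => rw [ih h.2.1, ih' h.2.2]
    all_goals simp at h
  | choice M M' ih ih' =>
    intro N h
    cases N <;> simp only [code, Nat.pair_eq_pair] at h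
    case choice N N' => rw [ih h.2.1, ih' h.2.2]
    all_goals simp at h

instance {n : ℕ} : Countable (Tm n) := code_injective.countable

end Tm

/-! ### Call-by-name semantics

A value is a closed abstraction `λx.P`; it is represented by its body `P : Tm 1`. -/

/-- Big-step call-by-name approximation semantics: `BigStep M D` is `M ⇓ D`, where `D` is a value
distribution of finite support. -/
inductive BigStep : Tm 0 → (Tm 1 →₀ ℝ≥0) → Prop
  | bt (M : Tm 0) : BigStep M 0
  | bv (P : Tm 1) : BigStep (Tm.lam P) (Finsupp.single P 1)
  | ba (M N : Tm 0) (D : Tm 1 →₀ ℝ≥0) (E : Tm 1 → Tm 1 →₀ ℝ≥0) :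
      BigStep M D → (∀ P ∈ D.support, BigStep (P.inst N) (E P)) →
      BigStep (Tm.app M N) (D.sum fun P d => d • E P)
  | bs (M N : Tm 0) (D E : Tm 1 →₀ ℝ≥0) :
      BigStep M D → BigStep N E →
      BigStep (Tm.choice M N) ((1 / 2 : ℝ≥0) • D + (1 / 2 : ℝ≥0) • E)

/-- The semantics `⟦M⟧` of a closed term, the least upper bound of its approximations;
`sem M P` is the probability of the value `λx.P`. -/
noncomputable def sem (M : Tm 0) (P : Tm 1) : ℝ≥0∞ :=
  ⨆ D : {D : Tm 1 →₀ ℝ≥0 // BigStep M D}, (D.1 P : ℝ≥0∞)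

theorem Tm.sum_smul_mono (D D' : Tm 1 →₀ ℝ≥0) (E E' : Tm 1 → Tm 1 →₀ ℝ≥0) (hD : D ≤ D')
    (hE : ∀ P ∈ D.support, E P ≤ E' P) :
    (D.sum fun P d => d • E P) ≤ D'.sum fun P d => d • E' P := by
  classical
  have hs : D.support ⊆ D'.support := Finsupp.support_mono hD
  unfold Finsupp.sum
  refine (Finset.sum_le_sum (g := fun P => D' P • E' P) fun P hP => ?_).trans
    (Finset.sum_le_sum_of_subset hs)
  intro Q
  simp only [Finsupp.smul_apply, smul_eq_mul]
  exact mul_le_mul' (hD P) (hE P hP Q)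

theorem BigStep.directed {M : Tm 0} {D : Tm 1 →₀ ℝ≥0} (h : BigStep M D) :
    ∀ D', BigStep M D' → ∃ D'', BigStep M D'' ∧ D ≤ D'' ∧ D' ≤ D'' := by
  classical
  induction h with
  | bt M => exact fun D' h' => ⟨D', h', zero_le, le_rfl⟩
  | bv P =>
    intro D' h'
    cases h' with
    | bt => exact ⟨_, .bv P, le_rfl, zero_le⟩
    | bv => exact ⟨_, .bv P, le_rfl, le_rfl⟩
  | ba M N D E hM hE ihM ihE =>
    intro D' h'
    cases h' with
    | bt => exact ⟨_, .ba M N D E hM hE, le_rfl, zero_le⟩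
    | ba _ _ D₂ E₂ hM₂ hE₂ =>
      obtain ⟨D₃, hM₃, h1, h2⟩ := ihM D₂ hM₂
      have key : ∀ P, ∃ F, BigStep (P.inst N) F ∧ (P ∈ D.support → E P ≤ F) ∧
          (P ∈ D₂.support → E₂ P ≤ F) := by
        intro P
        by_cases hP : P ∈ D.support
        · by_cases hP₂ : P ∈ D₂.support
          · obtain ⟨F, hF, a, b⟩ := ihE P hP _ (hE₂ P hP₂)
            exact ⟨F, hF, fun _ => a, fun _ => b⟩
          · exact ⟨E P, hE P hP, fun _ => le_rfl, fun h => absurd h hP₂⟩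
        · by_cases hP₂ : P ∈ D₂.support
          · exact ⟨E₂ P, hE₂ P hP₂, fun h => absurd h hP, fun _ => le_rfl⟩
          · exact ⟨0, .bt _, fun h => absurd h hP, fun h => absurd h hP₂⟩
      choose F hF a b using key
      exact ⟨_, .ba M N D₃ F hM₃ fun P _ => hF P,
        Tm.sum_smul_mono _ _ _ _ h1 a, Tm.sum_smul_mono _ _ _ _ h2 b⟩
  | bs M N D E hM hN ihM ihN =>
    intro D' h'
    cases h' with
    | bt => exact ⟨_, .bs M N D E hM hN, le_rfl, zero_le⟩
    | bs _ _ D₂ E₂ hM₂ hN₂ =>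
      obtain ⟨D₃, hM₃, h1, h2⟩ := ihM D₂ hM₂
      obtain ⟨E₃, hN₃, h3, h4⟩ := ihN E₂ hN₂
      refine ⟨_, .bs M N D₃ E₃ hM₃ hN₃, ?_, ?_⟩ <;> intro Q <;>
        simp only [Finsupp.add_apply, Finsupp.smul_apply, smul_eq_mul] <;> gcongr
      exacts [h1 Q, h3 Q, h2 Q, h4 Q]

theorem BigStep.mass_le {M : Tm 0} {D : Tm 1 →₀ ℝ≥0} (h : BigStep M D) :
    (D.sum fun _ d => d) ≤ 1 := by
  classical
  have hadd : ∀ F G : Tm 1 →₀ ℝ≥0,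
      ((F + G).sum fun _ d => d) = (F.sum fun _ d => d) + G.sum fun _ d => d := fun F G =>
    Finsupp.sum_add_index' (fun _ => rfl) (fun _ _ _ => rfl)
  have hmul : ∀ (c : ℝ≥0) (F : Tm 1 →₀ ℝ≥0),
      ((c • F).sum fun _ d => d) = c * F.sum fun _ d => d := fun c F => by
    rw [Finsupp.sum_smul_index' (fun _ => rfl), Finsupp.sum, Finsupp.sum, Finset.mul_sum]
    rfl
  induction h with
  | bt M => simp
  | bv P => simp
  | ba M N D E hM hE ihM ihE =>
    have h1 : ((D.sum fun P d => d • E P).sum fun _ d => d) =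
        ∑ P ∈ D.support, D P * (E P).sum fun _ d => d := by
      change ((∑ P ∈ D.support, D P • E P).sum fun _ d => d) = _
      rw [← Finsupp.sum_finsetSum_index (h := fun _ d => d) (fun _ => rfl) (fun _ _ _ => rfl)]
      exact Finset.sum_congr rfl fun P _ => hmul _ _
    rw [h1]
    calc ∑ P ∈ D.support, (D P * (E P).sum fun _ d => d) ≤ ∑ P ∈ D.support, D P := by
          refine Finset.sum_le_sum fun P hP => ?_
          simpa using mul_le_mul' (le_refl (D P)) (ihE P hP)
      _ ≤ 1 := ihM
  | bs M N D E hM hN ihM ihN =>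
    rw [hadd, hmul, hmul]
    calc _ ≤ (1 / 2 : ℝ≥0) * 1 + 1 / 2 * 1 := by gcongr
      _ = 1 := by rw [mul_one, add_halves]

/-- `⟦M⟧` is a value distribution: its total mass is at most `1`. -/
theorem tsum_sem_le (M : Tm 0) : ∑' P, sem M P ≤ 1 := by
  rw [ENNReal.tsum_eq_iSup_sum]
  refine iSup_le fun s => ?_
  have hsum : ∑ P ∈ s, sem M P =
      ⨆ D : {D : Tm 1 →₀ ℝ≥0 // BigStep M D}, ∑ P ∈ s, (D.1 P : ℝ≥0∞) := by
    refine ENNReal.finsetSum_iSup fun D D' => ?_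
    obtain ⟨F, hF, h1, h2⟩ := D.2.directed D'.1 D'.2
    exact ⟨⟨F, hF⟩, fun P => ⟨by exact_mod_cast h1 P, by exact_mod_cast h2 P⟩⟩
  rw [hsum]
  refine iSup_le fun D => ?_
  have h1 : ∑ P ∈ s, D.1 P ≤ 1 := by
    classical
    refine le_trans ?_ D.2.mass_le
    rw [Finsupp.sum_of_support_subset D.1 (s := s ∪ D.1.support) Finset.subset_union_right
      _ (fun _ _ => rfl)]
    exact Finset.sum_le_sum_of_subset Finset.subset_union_left
  exact_mod_cast h1

/-! ### Formal sums and the extended language -/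

/-- A formal sum `∑_{i ∈ I} ⟨M_i; p_i⟩` of closed terms, over a countable index set, with nonnegative
weights whose total is at most `1`. -/
structure FSum where
  ι : Type
  countable : Countable ι
  term : ι → Tm 0
  p : ι → ℝ≥0∞
  le_one : ∑' i, p i ≤ 1

/-- A formally summed value `∑_{i ∈ I} ⟨λx.M_i; p_i⟩`, given by the bodies `M_i`. -/
structure FSVal where
  ι : Type
  countable : Countable ι
  body : ι → Tm 1
  p : ι → ℝ≥0∞
  le_one : ∑' i, p i ≤ 1

namespace FSVal

/-- A formally summed value as a formal sum. -/
def toFSum (Z : FSVal) : FSum where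
  ι := Z.ι
  countable := Z.countable
  term i := Tm.lam (Z.body i)
  p := Z.p
  le_one := Z.le_one

/-- The sum of the weights. -/
noncomputable def prob (Z : FSVal) : ℝ≥0∞ := ∑' i, Z.p i

/-- `Z • N = ∑_i ⟨M_i{N/x}; p_i⟩` for `Z = ∑_i ⟨λx.M_i; p_i⟩`. -/
def bullet (Z : FSVal) (N : Tm 0) : FSum where
  ι := Z.ι
  countable := Z.countable
  term i := (Z.body i).inst N
  p := Z.p
  le_one := Z.le_one

end FSVal

namespace FSum

/-- `⟨M; 1⟩` -/
def single (M : Tm 0) : FSum where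
  ι := Unit
  countable := inferInstance
  term _ := M
  p _ := 1
  le_one := by simp

/-- `⟨M; 1/2⟩ + ⟨N; 1/2⟩` -/
noncomputable def half (M N : Tm 0) : FSum where
  ι := Bool
  countable := inferInstance
  term b := bif b then M else N
  p _ := 2⁻¹
  le_one := by simp

/-- `∑_i ⟨⟦M_i⟧; p_i⟩`, that is `∑_{(i, V)} ⟨V; ⟦M_i⟧(V) · p_i⟩`, for the formal sum
`∑_i ⟨M_i; p_i⟩`. -/
noncomputable def eval (H : FSum) : FSVal where
  ι := H.ι × Tm 1
  countable := by have := H.countable; infer_instance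
  body iP := iP.2
  p iP := sem (H.term iP.1) iP.2 * H.p iP.1
  le_one := by
    rw [ENNReal.tsum_prod (f := fun i P => sem (H.term i) P * H.p i)]
    refine le_trans (ENNReal.tsum_le_tsum fun i => ?_) H.le_one
    rw [ENNReal.tsum_mul_right]
    simpa using mul_le_mul' (tsum_sem_le (H.term i)) (le_refl (H.p i))

end FSum

/-- Closed terms of the language `Λ⊕^FS` with formal sums in redex position. -/
inductive FSTm : Type 1
  | app (E : FSTm) (M : Tm 0) : FSTm
  | sum (H : FSum) : FSTm
  | choice (M N : Tm 0) : FSTm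
  | lam (M : Tm 1) : FSTm

/-- The inclusion of the closed `Λ⊕`-terms in the closed `Λ⊕^FS`-terms. -/
def FSTm.ofTm : Tm 0 → FSTm
  | .var i => i.elim0
  | .lam M => .lam M
  | .app M N => .app (ofTm M) N
  | .choice M N => .choice M N

/-- The formally summed value `Z` as a term. -/
def FSTm.val (Z : FSVal) : FSTm := .sum Z.toFSum

/-- The reduction relation `E ⇝ F`. -/
inductive Step : FSTm → FSTm → Prop
  | ss (M N : Tm 0) : Step (.choice M N) (.sum (FSum.half M N))
  | sl (M : Tm 1) : Step (.lam M) (.sum (FSum.single (Tm.lam M)))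
  | spc (H : FSum) (i : H.ι) (hi : ∀ P : Tm 1, H.term i ≠ Tm.lam P) :
      Step (.sum H) (.val H.eval)
  | sp (Z : FSVal) (M : Tm 0) : Step (.app (.val Z) M) (.sum (Z.bullet M))
  | sa (E F : FSTm) (M : Tm 0) : Step E F → Step (.app E M) (.app F M)

/-- The reflexive and transitive closure of `⇝`. -/
abbrev Steps : FSTm → FSTm → Prop := Relation.ReflTransGen Step

/-! ### Contexts -/

/-- Single-hole `Λ⊕`-contexts; `Ctx m n` consists of the contexts that map terms over `m` variables
to terms over `n` variables (the context may capture variables). -/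
inductive Ctx (m : ℕ) : ℕ → Type
  | hole : Ctx m m
  | lam {n : ℕ} (C : Ctx m (n + 1)) : Ctx m n
  | appL {n : ℕ} (C : Ctx m n) (M : Tm n) : Ctx m n
  | appR {n : ℕ} (M : Tm n) (C : Ctx m n) : Ctx m n
  | choiceL {n : ℕ} (C : Ctx m n) (M : Tm n) : Ctx m n
  | choiceR {n : ℕ} (M : Tm n) (C : Ctx m n) : Ctx m n

/-- `C.fill L` is `C[L]`. -/
def Ctx.fill {m : ℕ} : {n : ℕ} → Ctx m n → Tm m → Tm n
  | _, .hole, L => L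
  | _, .lam C, L => .lam (C.fill L)
  | _, .appL C M, L => .app (C.fill L) M
  | _, .appR M C, L => .app M (C.fill L)
  | _, .choiceL C M, L => .choice (C.fill L) M
  | _, .choiceR M C, L => .choice M (C.fill L)

/-- Multi-hole `Λ⊕`-contexts over `n` free variables, with holes labelled by `Fin k`, to be filled
with closed terms. -/
inductive MCtx (k : ℕ) : ℕ → Type
  | hole {n : ℕ} (i : Fin k) : MCtx k n
  | var {n : ℕ} (i : Fin n) : MCtx k n
  | lam {n : ℕ} (C : MCtx k (n + 1)) : MCtx k n
  | app {n : ℕ} (C D : MCtx k n) : MCtx k n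
  | choice {n : ℕ} (C D : MCtx k n) : MCtx k n

/-- Filling the holes of a multi-hole context with closed terms. -/
def MCtx.fill {k : ℕ} (Ms : Fin k → Tm 0) : {n : ℕ} → MCtx k n → Tm n
  | _, .hole i => (Ms i).weaken
  | _, .var i => .var i
  | _, .lam C => .lam (C.fill Ms)
  | _, .app C D => .app (C.fill Ms) (D.fill Ms)
  | _, .choice C D => .choice (C.fill Ms) (D.fill Ms)

/-- The context closure `V*` of a relation `V` on closed `Λ⊕`-terms: the pairs of closed terms
`(C[M₁,…,M_k], C[N₁,…,N_k])` with `M_i V N_i` for each `i`. -/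
def Star (V : Tm 0 → Tm 0 → Prop) (M N : Tm 0) : Prop :=
  ∃ (k : ℕ) (C : MCtx k 0) (Ms Ns : Fin k → Tm 0),
    (∀ i, V (Ms i) (Ns i)) ∧ M = C.fill Ms ∧ N = C.fill Ns

/-- (Closed) evaluation contexts `[·] M₁ ⋯ M_k`. -/
inductive EvalCtx : Type
  | hole : EvalCtx
  | app (C : EvalCtx) (M : Tm 0) : EvalCtx

/-- `C.fill E` is `C[E]`. -/
def EvalCtx.fill : EvalCtx → FSTm → FSTm
  | .hole, E => E
  | .app C M, E => .app (C.fill E) M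

/-! ### Coupled logical bisimilarity -/

/-- A coupled relation `(V, E)`: relations on closed `Λ⊕`-terms and on closed `Λ⊕^FS`-terms,
with `V ⊆ E`. -/
structure CoupledRel where
  fst : Tm 0 → Tm 0 → Prop
  snd : FSTm → FSTm → Prop
  fst_le_snd : ∀ M N, fst M N → snd (.ofTm M) (.ofTm N)

/-- Coupled logical bisimulations. -/
structure CoupledRel.IsBisim (R : CoupledRel) : Prop where
  step : ∀ E F, R.snd E F → ∀ D, Step E D → ∃ G, Steps F G ∧ R.snd D G
  val : ∀ (Z : FSVal) F, R.snd (.val Z) F →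
    ∃ Y : FSVal, Steps F (.val Y) ∧ Z.prob = Y.prob ∧
      ∀ M N, Star R.fst M N → R.snd (.sum (Z.bullet M)) (.sum (Y.bullet N))
  step_symm : ∀ E F, R.snd E F → ∀ G, Step F G → ∃ D, Steps E D ∧ R.snd D G
  val_symm : ∀ E (Y : FSVal), R.snd E (.val Y) →
    ∃ Z : FSVal, Steps E (.val Z) ∧ Z.prob = Y.prob ∧
      ∀ M N, Star R.fst M N → R.snd (.sum (Z.bullet M)) (.sum (Y.bullet N))

/-- `M ≈₁ N`: the union of the first components of all coupled logical bisimulations. -/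
def Bisim₁ (M N : Tm 0) : Prop := ∃ R : CoupledRel, R.IsBisim ∧ R.fst M N

/-- `E ≈₂ F`: the union of the second components of all coupled logical bisimulations. -/
def Bisim₂ (E F : FSTm) : Prop := ∃ R : CoupledRel, R.IsBisim ∧ R.snd E F

/-- The extension of `≈₁` to open terms by closure under closing substitutions. -/
def OpenBisim₁ {n : ℕ} (M N : Tm n) : Prop :=
  ∀ σ : Fin n → Tm 0, Bisim₁ (M.subst σ) (N.subst σ)

end CoupledLB

open CoupledLB

namespace CoupledLB

/-! ### Substitution -/

namespace Tm

/-! Both bisimilarities coincide with an observational equivalence: equal probability of convergence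
against every stack of closed arguments. Congruence is then proved for that equivalence. Bisimilar
terms have equal observations (`CoupledRel.IsBisim.obs_eq`): every extended term reduces to a
formally summed value, reduction preserves observations, and a bisimulation matches total weights
and allows both values to be fed the same argument. Conversely, equality of observations is itself a
coupled logical bisimulation (`obsRel_isBisim`). The delicate clause is the one on values, whose
arguments are related by the context closure, so it already needs congruence. This comes from Howe's
method: the Howe closure is compatible and substitutive by construction, and `Howe.obsN_le_obs`
shows that it does not decrease observations. Since observations are suprema over the number of
machine steps, that lemma is a plain induction on this number, with no splitting of probability
distributions. Evaluation contexts need no such argument: they only push terms on the stack. -/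

theorem lift_var {n : ℕ} :
    (Fin.cases (var 0) (fun i => rename Fin.succ (var i)) : Fin (n + 1) → Tm (n + 1)) = var := by
  funext i
  cases i using Fin.cases <;> rfl

theorem subst_var {n : ℕ} (M : Tm n) : M.subst var = M := by
  induction M with
  | var i => rfl
  | lam M ih => rw [subst, lift_var, ih]
  | app M N ihM ihN => rw [subst, ihM, ihN]
  | choice M N ihM ihN => rw [subst, ihM, ihN]

theorem rename_eq_subst {m n : ℕ} (ρ : Fin m → Fin n) (M : Tm m) :
    M.rename ρ = M.subst (fun i => var (ρ i)) := by
  induction M generalizing n with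
  | var i => rfl
  | lam M ih =>
    rw [rename, subst, ih]
    congr 2
    funext i
    cases i using Fin.cases <;> rfl
  | app M N ihM ihN => rw [rename, subst, ihM, ihN]
  | choice M N ihM ihN => rw [rename, subst, ihM, ihN]

theorem subst_rename {l m n : ℕ} (ρ : Fin l → Fin m) (σ : Fin m → Tm n) (M : Tm l) :
    (M.rename ρ).subst σ = M.subst (fun i => σ (ρ i)) := by
  induction M generalizing m n with
  | var i => rfl
  | lam M ih =>
    rw [rename, subst, subst, ih]
    congr 2
    funext i
    cases i using Fin.cases <;> rfl
  | app M N ihM ihN => rw [rename, subst, subst, ihM, ihN]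
  | choice M N ihM ihN => rw [rename, subst, subst, ihM, ihN]

theorem rename_rename {l m n : ℕ} (ρ : Fin l → Fin m) (ρ' : Fin m → Fin n) (M : Tm l) :
    (M.rename ρ).rename ρ' = M.rename (fun i => ρ' (ρ i)) := by
  rw [rename_eq_subst ρ', subst_rename, rename_eq_subst]

theorem rename_subst {l m n : ℕ} (σ : Fin l → Tm m) (ρ : Fin m → Fin n) (M : Tm l) :
    (M.subst σ).rename ρ = M.subst (fun i => (σ i).rename ρ) := by
  induction M generalizing m n with
  | var i => rfl
  | lam M ih =>
    rw [subst, rename, subst, ih]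
    congr 2
    funext i
    cases i using Fin.cases with
    | zero => rfl
    | succ i => simp [rename_rename]
  | app M N ihM ihN => rw [subst, rename, subst, ihM, ihN]
  | choice M N ihM ihN => rw [subst, rename, subst, ihM, ihN]

theorem subst_subst {l m n : ℕ} (σ : Fin l → Tm m) (τ : Fin m → Tm n) (M : Tm l) :
    (M.subst σ).subst τ = M.subst (fun i => (σ i).subst τ) := by
  induction M generalizing m n with
  | var i => rfl
  | lam M ih =>
    rw [subst, subst, subst, ih]
    congr 2
    funext i
    cases i using Fin.cases with
    | zero => rfl
    | succ i => simp [subst_rename, rename_subst]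
  | app M N ihM ihN => rw [subst, subst, subst, ihM, ihN]
  | choice M N ihM ihN => rw [subst, subst, subst, ihM, ihN]

theorem subst_closed (σ : Fin 0 → Tm 0) (M : Tm 0) : M.subst σ = M := by
  rw [Subsingleton.elim σ var, subst_var]

theorem subst_weaken {n : ℕ} (σ : Fin n → Tm 0) (M : Tm 0) : (M.weaken : Tm n).subst σ = M := by
  rw [weaken, subst_rename, subst_closed]

end Tm

/-! ### Observation of a term against a stack of arguments -/

/-- The probability that `M` applied to the arguments `s` converges within `n` steps of the
call-by-name abstract machine. -/
noncomputable def obsN : ℕ → Tm 0 → List (Tm 0) → ℝ≥0∞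
  | 0, _, _ => 0
  | _ + 1, .var _, _ => 0
  | _ + 1, .lam _, [] => 1
  | n + 1, .lam P, N :: s => obsN n (P.inst N) s
  | n + 1, .app M N, s => obsN n M (N :: s)
  | n + 1, .choice M N, s => 2⁻¹ * obsN n M s + 2⁻¹ * obsN n N s

/-- The probability that `M` applied to the arguments `s` converges. -/
noncomputable def obs (M : Tm 0) (s : List (Tm 0)) : ℝ≥0∞ := ⨆ n, obsN n M s

theorem obsN_le_succ (n : ℕ) (M : Tm 0) (s : List (Tm 0)) : obsN n M s ≤ obsN (n + 1) M s := by
  induction n generalizing M s with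
  | zero => simp [obsN]
  | succ n ih =>
    cases M with
    | var i => exact i.elim0
    | lam P =>
      cases s with
      | nil => simp [obsN]
      | cons N s => exact ih _ _
    | app M N => exact ih _ _
    | choice M N =>
      rw [obsN, obsN]
      gcongr <;> exact ih _ _

theorem obsN_mono (M : Tm 0) (s : List (Tm 0)) : Monotone fun n => obsN n M s :=
  monotone_nat_of_le_succ fun n => obsN_le_succ n M s

theorem obsN_le_obs (n : ℕ) (M : Tm 0) (s : List (Tm 0)) : obsN n M s ≤ obs M s :=
  le_iSup (fun n => obsN n M s) n

/-- Zero steps contribute `0`, so the supremum may start at one step; the defining equations of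
`obsN` thereby pass to the limit. -/
theorem obs_eq_iSup_succ (M : Tm 0) (s : List (Tm 0)) : obs M s = ⨆ n, obsN (n + 1) M s := by
  rw [obs, ← sup_iSup_nat_succ]
  simp [obsN]

@[simp] theorem obs_lam_nil (P : Tm 1) : obs (.lam P) [] = 1 := by
  simp [obs_eq_iSup_succ, obsN]

@[simp] theorem obs_lam_cons (P : Tm 1) (N : Tm 0) (s : List (Tm 0)) :
    obs (.lam P) (N :: s) = obs (P.inst N) s := by
  rw [obs_eq_iSup_succ]
  rfl

@[simp] theorem obs_app (M N : Tm 0) (s : List (Tm 0)) : obs (.app M N) s = obs M (N :: s) := by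
  rw [obs_eq_iSup_succ]
  rfl

@[simp] theorem obs_choice (M N : Tm 0) (s : List (Tm 0)) :
    obs (.choice M N) s = 2⁻¹ * obs M s + 2⁻¹ * obs N s := by
  rw [obs_eq_iSup_succ, obs, obs, ENNReal.mul_iSup, ENNReal.mul_iSup,
    ENNReal.iSup_add_iSup_of_monotone]
  · rfl
  · exact fun m n h => mul_le_mul' le_rfl (obsN_mono M s h)
  · exact fun m n h => mul_le_mul' le_rfl (obsN_mono N s h)

/-! ### Observation and the big-step semantics -/

/-- The expectation of `c` under a finitely supported distribution. -/
noncomputable def expect (D : Tm 1 →₀ ℝ≥0) (c : Tm 1 → ℝ≥0∞) : ℝ≥0∞ :=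
  D.sum fun P d => d * c P

@[simp] theorem expect_zero (c : Tm 1 → ℝ≥0∞) : expect 0 c = 0 := by
  simp [expect]

@[simp] theorem expect_single (P : Tm 1) (c : Tm 1 → ℝ≥0∞) :
    expect (Finsupp.single P 1) c = c P := by
  simp [expect]

theorem expect_add (D E : Tm 1 →₀ ℝ≥0) (c : Tm 1 → ℝ≥0∞) :
    expect (D + E) c = expect D c + expect E c := by
  classical
  exact Finsupp.sum_add_index' (fun _ => by simp) (fun _ _ _ => by push_cast; ring)

theorem expect_smul (a : ℝ≥0) (D : Tm 1 →₀ ℝ≥0) (c : Tm 1 → ℝ≥0∞) :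
    expect (a • D) c = a * expect D c := by
  rw [expect, Finsupp.sum_smul_index' (fun _ => by simp), expect, Finsupp.sum, Finsupp.sum,
    Finset.mul_sum]
  refine Finset.sum_congr rfl fun P _ => ?_
  rw [smul_eq_mul, ENNReal.coe_mul, mul_assoc]

theorem expect_bind (D : Tm 1 →₀ ℝ≥0) (E : Tm 1 → Tm 1 →₀ ℝ≥0) (c : Tm 1 → ℝ≥0∞) :
    expect (D.sum fun P d => d • E P) c = expect D fun P => expect (E P) c := by
  classical
  have h : ∀ s : Finset (Tm 1), expect (∑ P ∈ s, D P • E P) c =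
      ∑ P ∈ s, (D P : ℝ≥0∞) * expect (E P) c := by
    intro s
    induction s using Finset.induction_on with
    | empty => simp
    | insert P s hP ih => rw [Finset.sum_insert hP, Finset.sum_insert hP, expect_add, ih, expect_smul]
  exact h _

theorem expect_mono (D : Tm 1 →₀ ℝ≥0) (c c' : Tm 1 → ℝ≥0∞) (h : ∀ P ∈ D.support, c P ≤ c' P) :
    expect D c ≤ expect D c' :=
  Finset.sum_le_sum fun P hP => mul_le_mul' le_rfl (h P hP)

theorem expect_eq_tsum (D : Tm 1 →₀ ℝ≥0) (c : Tm 1 → ℝ≥0∞) :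
    expect D c = ∑' P, (D P : ℝ≥0∞) * c P := by
  rw [tsum_eq_sum (s := D.support)]
  · rfl
  · intro P hP
    simp [Finsupp.notMem_support_iff.1 hP]

theorem coe_half : (((1 / 2 : ℝ≥0)) : ℝ≥0∞) = 2⁻¹ := by
  rw [one_div, ENNReal.coe_inv two_ne_zero]
  rfl

/-- The stack must stay arbitrary in the induction, since an application moves its argument onto it.
-/
theorem BigStep.expect_obs_le {M : Tm 0} {D : Tm 1 →₀ ℝ≥0} (h : BigStep M D) (s : List (Tm 0)) :
    expect D (fun P => obs (.lam P) s) ≤ obs M s := by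
  induction h generalizing s with
  | bt M => simp
  | bv P => simp
  | ba M N D E hM hE ihM ihE =>
    rw [expect_bind, obs_app]
    refine (expect_mono _ _ _ fun P hP => ?_).trans (ihM (N :: s))
    rw [obs_lam_cons]
    exact ihE P hP s
  | bs M N D E hM hN ihM ihN =>
    rw [expect_add, expect_smul, expect_smul, obs_choice, coe_half]
    gcongr
    exacts [ihM s, ihN s]

/-- The bound on the right stays step-indexed so that, for an application, the induction applies a
second time, to the bodies after substitution; this second use is at a smaller index still, whence
strong induction. -/
theorem exists_bigStep_obsN_le (n : ℕ) (M : Tm 0) (s : List (Tm 0)) :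
    ∃ D, BigStep M D ∧ obsN n M s ≤ expect D fun P => obsN n (.lam P) s := by
  induction n using Nat.strong_induction_on generalizing M s with
  | _ n ih =>
    cases n with
    | zero => exact ⟨0, .bt M, by simp [obsN]⟩
    | succ n =>
      cases M with
      | var i => exact i.elim0
      | lam P => exact ⟨_, .bv P, by simp⟩
      | app M N =>
        obtain ⟨D, hD, h⟩ := ih n n.lt_succ_self M (N :: s)
        have h' : ∀ P, ∃ E, BigStep (P.inst N) E ∧
            obsN n (.lam P) (N :: s) ≤ expect E fun Q => obsN (n + 1) (.lam Q) s := by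
          intro P
          -- Popping the argument costs one step: with none left the observation is `0` and the
          -- empty approximation suffices.
          cases n with
          | zero => exact ⟨0, .bt _, by simp [obsN]⟩
          | succ n =>
            obtain ⟨E, hE, h'⟩ := ih n (by omega) (P.inst N) s
            exact ⟨E, hE, h'.trans (expect_mono _ _ _ fun Q _ =>
              obsN_mono (.lam Q) s (by omega : n ≤ n + 1 + 1))⟩
        choose E hE h' using h'
        refine ⟨_, .ba M N D E hD fun P _ => hE P, ?_⟩
        rw [expect_bind]
        exact h.trans (expect_mono _ _ _ fun P _ => h' P)
      | choice M N =>
        obtain ⟨D, hD, h⟩ := ih n n.lt_succ_self M s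
        obtain ⟨E, hE, h'⟩ := ih n n.lt_succ_self N s
        refine ⟨_, .bs M N D E hD hE, ?_⟩
        rw [expect_add, expect_smul, expect_smul, coe_half, obsN]
        gcongr
        · exact h.trans (expect_mono _ _ _ fun P _ => obsN_le_succ _ _ _)
        · exact h'.trans (expect_mono _ _ _ fun P _ => obsN_le_succ _ _ _)

/-- The link between the abstract machine and the big-step semantics; it is what makes the
evaluation rule for formal sums preserve observations. -/
theorem obs_eq_tsum_sem (M : Tm 0) (s : List (Tm 0)) :
    obs M s = ∑' P, sem M P * obs (.lam P) s := by
  apply le_antisymm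
  · refine iSup_le fun n => ?_
    obtain ⟨D, hD, h⟩ := exists_bigStep_obsN_le n M s
    refine h.trans ?_
    rw [expect_eq_tsum]
    refine ENNReal.tsum_le_tsum fun P => mul_le_mul' ?_ (obsN_le_obs _ _ _)
    exact le_iSup (fun D : {D : Tm 1 →₀ ℝ≥0 // BigStep M D} => (D.1 P : ℝ≥0∞)) ⟨D, hD⟩
  · rw [ENNReal.tsum_eq_iSup_sum]
    refine iSup_le fun t => ?_
    -- Big-step approximations are directed, so the supremum commutes with the finite sum.
    have hsum : ∑ P ∈ t, sem M P * obs (.lam P) s =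
        ⨆ D : {D : Tm 1 →₀ ℝ≥0 // BigStep M D}, ∑ P ∈ t, (D.1 P : ℝ≥0∞) * obs (.lam P) s := by
      simp only [sem, ENNReal.iSup_mul]
      refine ENNReal.finsetSum_iSup fun D D' => ?_
      obtain ⟨F, hF, h1, h2⟩ := D.2.directed D'.1 D'.2
      refine ⟨⟨F, hF⟩, fun P => ⟨mul_le_mul' ?_ le_rfl, mul_le_mul' ?_ le_rfl⟩⟩
      exacts [by exact_mod_cast h1 P, by exact_mod_cast h2 P]
    rw [hsum]
    refine iSup_le fun D => le_trans ?_ (D.2.expect_obs_le s)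
    rw [expect_eq_tsum]
    exact ENNReal.sum_le_tsum t

/-! ### Observation of extended terms -/

/-- The probability that a closed term of the extended language, applied to the arguments `s`,
converges. -/
noncomputable def FSTm.obs : FSTm → List (Tm 0) → ℝ≥0∞
  | .app E M, s => E.obs (M :: s)
  | .sum H, s => ∑' i, H.p i * CoupledLB.obs (H.term i) s
  | .choice M N, s => CoupledLB.obs (.choice M N) s
  | .lam M, s => CoupledLB.obs (.lam M) s

@[simp] theorem FSTm.obs_ofTm : ∀ (M : Tm 0) (s : List (Tm 0)),
    (FSTm.ofTm M).obs s = CoupledLB.obs M s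
  | .var i, _ => i.elim0
  | .lam M, s => by rw [FSTm.ofTm, FSTm.obs]
  | .app M N, s => by rw [FSTm.ofTm, FSTm.obs, obs_app, FSTm.obs_ofTm M]
  | .choice M N, s => by rw [FSTm.ofTm, FSTm.obs]

@[simp] theorem FSTm.obs_val_nil (Z : FSVal) : (FSTm.val Z).obs [] = Z.prob := by
  simp [FSTm.val, FSTm.obs, FSVal.toFSum, FSVal.prob]

@[simp] theorem FSTm.obs_val_cons (Z : FSVal) (M : Tm 0) (s : List (Tm 0)) :
    (FSTm.val Z).obs (M :: s) = (FSTm.sum (Z.bullet M)).obs s := by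
  simp [FSTm.val, FSTm.obs, FSVal.toFSum, FSVal.bullet]

theorem Step.obs_eq {E F : FSTm} (h : Step E F) (s : List (Tm 0)) : E.obs s = F.obs s := by
  induction h generalizing s with
  | ss M N => simp [FSTm.obs, FSum.half]
  | sl M => simp [FSTm.obs, FSum.single]
  | spc H i hi =>
    simp only [FSTm.obs, FSTm.val, FSVal.toFSum, FSum.eval]
    rw [ENNReal.tsum_prod (f := fun i P => sem (H.term i) P * H.p i * CoupledLB.obs (.lam P) s)]
    refine tsum_congr fun i => ?_
    rw [obs_eq_tsum_sem, ← ENNReal.tsum_mul_left]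
    exact tsum_congr fun P => by ring
  | sp Z M => exact FSTm.obs_val_cons Z M s
  | sa E F M _ ih => exact ih (M :: s)

theorem Steps.obs_eq {E F : FSTm} (h : Steps E F) (s : List (Tm 0)) : E.obs s = F.obs s := by
  induction h with
  | refl => rfl
  | tail _ h ih => exact ih.trans (h.obs_eq s)

/-- One step evaluates all summands at once if some summand is not a value; otherwise the sum is
already a value and no step is needed. -/
theorem exists_steps_val_sum (H : FSum) : ∃ Z, Steps (.sum H) (.val Z) := by
  by_cases h : ∃ i, ∀ P, H.term i ≠ Tm.lam P
  · obtain ⟨i, hi⟩ := h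
    exact ⟨_, .single (.spc H i hi)⟩
  · push Not at h
    choose b hb using h
    refine ⟨⟨H.ι, H.countable, b, H.p, H.le_one⟩, ?_⟩
    have : FSVal.toFSum ⟨H.ι, H.countable, b, H.p, H.le_one⟩ = H := by
      obtain ⟨ι, hc, t, p, hp⟩ := H
      exact congrArg (fun t => (⟨ι, hc, t, p, hp⟩ : FSum)) (funext hb).symm
    rw [FSTm.val, this]

/-- Divergence never blocks reduction: it only shows as missing weight. -/
theorem exists_steps_val (E : FSTm) : ∃ Z, Steps E (.val Z) := by
  induction E with
  | app E M ih =>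
    obtain ⟨Z, hZ⟩ := ih
    obtain ⟨Y, hY⟩ := exists_steps_val_sum (Z.bullet M)
    refine ⟨Y, Relation.ReflTransGen.trans ?_ (.head (.sp Z M) hY)⟩
    exact hZ.lift (fun E => FSTm.app E M) fun E F h => .sa E F M h
  | sum H => exact exists_steps_val_sum H
  | choice M N => exact (exists_steps_val_sum _).imp fun Z h => .head (.ss M N) h
  | lam M => exact (exists_steps_val_sum _).imp fun Z h => .head (.sl M) h

/-! ### Bisimilar terms have the same observations -/

/-- A closed term is a context without holes, whatever the relation. -/
theorem star_refl (V : Tm 0 → Tm 0 → Prop) (M : Tm 0) : Star V M M := by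
  have h : ∀ {n : ℕ} (M : Tm n), ∃ C : MCtx 0 n, ∀ Ms, C.fill Ms = M := by
    intro n M
    induction M with
    | var i => exact ⟨.var i, fun _ => rfl⟩
    | lam M ih => exact ih.elim fun C h => ⟨.lam C, fun Ms => by rw [MCtx.fill, h]⟩
    | app M N ihM ihN =>
      obtain ⟨⟨C, h⟩, D, h'⟩ := ihM, ihN
      exact ⟨.app C D, fun Ms => by rw [MCtx.fill, h, h']⟩
    | choice M N ihM ihN =>
      obtain ⟨⟨C, h⟩, D, h'⟩ := ihM, ihN
      exact ⟨.choice C D, fun Ms => by rw [MCtx.fill, h, h']⟩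
  obtain ⟨C, h⟩ := h M
  exact ⟨0, C, Fin.elim0, Fin.elim0, fun i => i.elim0, (h _).symm, (h _).symm⟩

theorem CoupledRel.IsBisim.exists_steps_val {R : CoupledRel} (hR : R.IsBisim) {E F : FSTm}
    (h : R.snd E F) : ∃ Z Y : FSVal, Steps E (.val Z) ∧ Steps F (.val Y) ∧ Z.prob = Y.prob ∧
      ∀ M N, Star R.fst M N → R.snd (.sum (Z.bullet M)) (.sum (Y.bullet N)) := by
  obtain ⟨Z, hZ⟩ := CoupledLB.exists_steps_val E
  have : ∃ G, Steps F G ∧ R.snd (.val Z) G := by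
    have key : ∀ {D}, Steps E D → ∃ G, Steps F G ∧ R.snd D G := by
      intro D hD
      induction hD with
      | refl => exact ⟨F, .refl, h⟩
      | tail _ hs ih =>
        obtain ⟨G, hG, hR'⟩ := ih
        obtain ⟨G', hG', hR''⟩ := hR.step _ _ hR' _ hs
        exact ⟨G', Relation.ReflTransGen.trans hG hG', hR''⟩
    exact key hZ
  obtain ⟨G, hG, hZG⟩ := this
  obtain ⟨Y, hY, hp, hb⟩ := hR.val Z G hZG
  exact ⟨Z, Y, hZ, Relation.ReflTransGen.trans hG hY, hp, hb⟩

/-- Induction on the stack: the empty stack reads off the total weight, and each further argument is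
fed identically to both values. -/
theorem CoupledRel.IsBisim.obs_eq {R : CoupledRel} (hR : R.IsBisim) {E F : FSTm}
    (h : R.snd E F) (s : List (Tm 0)) : E.obs s = F.obs s := by
  induction s generalizing E F with
  | nil =>
    obtain ⟨Z, Y, hZ, hY, hp, -⟩ := hR.exists_steps_val h
    rw [Steps.obs_eq hZ, Steps.obs_eq hY, FSTm.obs_val_nil, FSTm.obs_val_nil, hp]
  | cons M s ih =>
    obtain ⟨Z, Y, hZ, hY, -, hb⟩ := hR.exists_steps_val h
    rw [Steps.obs_eq hZ, Steps.obs_eq hY, FSTm.obs_val_cons, FSTm.obs_val_cons]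
    exact ih (hb M M (star_refl _ M))

/-! ### Observational equivalence is a congruence -/

/-- Two terms are observationally equivalent if all their closed instances have the same
probability of convergence against every stack of arguments. -/
def ObsEq {n : ℕ} (M N : Tm n) : Prop :=
  ∀ (σ : Fin n → Tm 0) (s : List (Tm 0)), obs (M.subst σ) s = obs (N.subst σ) s

namespace ObsEq

theorem refl {n : ℕ} (M : Tm n) : ObsEq M M := fun _ _ => rfl

theorem symm {n : ℕ} {M N : Tm n} (h : ObsEq M N) : ObsEq N M := fun σ s => (h σ s).symm

theorem trans {n : ℕ} {M N P : Tm n} (h : ObsEq M N) (h' : ObsEq N P) : ObsEq M P :=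
  fun σ s => (h σ s).trans (h' σ s)

theorem subst {m n : ℕ} {M N : Tm m} (h : ObsEq M N) (σ : Fin m → Tm n) :
    ObsEq (M.subst σ) (N.subst σ) := by
  intro τ s
  rw [Tm.subst_subst, Tm.subst_subst]
  exact h _ s

theorem rename {m n : ℕ} {M N : Tm m} (h : ObsEq M N) (ρ : Fin m → Fin n) :
    ObsEq (M.rename ρ) (N.rename ρ) := by
  rw [Tm.rename_eq_subst, Tm.rename_eq_subst]
  exact h.subst _

theorem closed_iff {M N : Tm 0} : ObsEq M N ↔ ∀ s, obs M s = obs N s := by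
  simp [ObsEq, Tm.subst_closed]

theorem weaken {M N : Tm 0} (h : ∀ s, obs M s = obs N s) (n : ℕ) :
    ObsEq (M.weaken : Tm n) N.weaken := by
  intro σ s
  rw [Tm.subst_weaken, Tm.subst_weaken, h]

end ObsEq

/-- The Howe closure of observational equivalence. -/
inductive Howe : {n : ℕ} → Tm n → Tm n → Prop
  | var {n : ℕ} (i : Fin n) {L : Tm n} : ObsEq (.var i) L → Howe (.var i) L
  | lam {n : ℕ} {M M' : Tm (n + 1)} {L : Tm n} :
      Howe M M' → ObsEq (.lam M') L → Howe (.lam M) L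
  | app {n : ℕ} {M M' N N' L : Tm n} :
      Howe M M' → Howe N N' → ObsEq (.app M' N') L → Howe (.app M N) L
  | choice {n : ℕ} {M M' N N' L : Tm n} :
      Howe M M' → Howe N N' → ObsEq (.choice M' N') L → Howe (.choice M N) L

namespace Howe

theorem refl {n : ℕ} (M : Tm n) : Howe M M := by
  induction M with
  | var i => exact .var i (.refl _)
  | lam M ih => exact .lam ih (.refl _)
  | app M N ihM ihN => exact .app ihM ihN (.refl _)
  | choice M N ihM ihN => exact .choice ihM ihN (.refl _)

/-- Every rule ends with an observational equivalence, which absorbs another one by transitivity. -/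
theorem trans_obsEq {n : ℕ} {M N L : Tm n} (h : Howe M N) (h' : ObsEq N L) : Howe M L := by
  cases h with
  | var i h => exact .var i (h.trans h')
  | lam hM h => exact .lam hM (h.trans h')
  | app hM hN h => exact .app hM hN (h.trans h')
  | choice hM hN h => exact .choice hM hN (h.trans h')

theorem of_obsEq {n : ℕ} {M N : Tm n} (h : ObsEq M N) : Howe M N := (refl M).trans_obsEq h

theorem rename {m n : ℕ} {M N : Tm m} (h : Howe M N) (ρ : Fin m → Fin n) :
    Howe (M.rename ρ) (N.rename ρ) := by
  induction h generalizing n with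
  | var i h => exact .var _ (h.rename ρ)
  | lam _ h ih => exact .lam (ih _) (h.rename ρ)
  | app _ _ h ihM ihN => exact .app (ihM ρ) (ihN ρ) (h.rename ρ)
  | choice _ _ h ihM ihN => exact .choice (ihM ρ) (ihN ρ) (h.rename ρ)

theorem subst {m n : ℕ} {M N : Tm m} (h : Howe M N) {σ τ : Fin m → Tm n}
    (hσ : ∀ i, Howe (σ i) (τ i)) : Howe (M.subst σ) (N.subst τ) := by
  induction h generalizing n with
  | var i h => exact (hσ i).trans_obsEq (h.subst τ)
  | lam _ h ih =>
    refine .lam (ih fun i => ?_) (h.subst τ)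
    cases i using Fin.cases with
    | zero => exact refl _
    | succ i => exact (hσ i).rename _
  | app _ _ h ihM ihN => exact .app (ihM hσ) (ihN hσ) (h.subst τ)
  | choice _ _ h ihM ihN => exact .choice (ihM hσ) (ihN hσ) (h.subst τ)

theorem inst {P Q : Tm 1} {M N : Tm 0} (h : Howe P Q) (h' : Howe M N) :
    Howe (P.inst M) (Q.inst N) :=
  h.subst fun _ => h'

/-- The key lemma of Howe's method. Only the left side is step-indexed, so the final observational
equivalence of each rule can be rewritten away on the right at no cost in steps. The stacks are
related pointwise because an application pushes arguments that are only Howe-related; substitutivity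
handles them when they are popped. -/
theorem obsN_le_obs (n : ℕ) {M N : Tm 0} (h : Howe M N) {s t : List (Tm 0)}
    (hs : List.Forall₂ Howe s t) : obsN n M s ≤ obs N t := by
  induction n generalizing M N s t with
  | zero => simp [obsN]
  | succ n ih =>
    cases h with
    | var i => exact i.elim0
    | lam hM h =>
      rw [← ObsEq.closed_iff.1 h]
      cases hs with
      | nil => simp [obsN]
      | cons hN hs =>
        rw [obs_lam_cons]
        exact ih (hM.inst hN) hs
    | app hM hN h =>
      rw [← ObsEq.closed_iff.1 h, obs_app]
      exact ih hM (.cons hN hs)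
    | choice hM hN h =>
      rw [← ObsEq.closed_iff.1 h, obs_choice, obsN]
      gcongr
      exacts [ih hM hs, ih hN hs]

theorem obs_le {M N : Tm 0} (h : Howe M N) (s : List (Tm 0)) : obs M s ≤ obs N s :=
  iSup_le fun n => h.obsN_le_obs n (List.forall₂_same.2 fun M _ => refl M)

/-- Assuming both directions avoids proving the Howe closure symmetric; observational equivalence
supplies both, being symmetric itself. -/
theorem obsEq {n : ℕ} {M N : Tm n} (h : Howe M N) (h' : Howe N M) : ObsEq M N := fun _ s =>
  le_antisymm ((h.subst fun _ => refl _).obs_le s) ((h'.subst fun _ => refl _).obs_le s)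

theorem fill {m n : ℕ} {M N : Tm m} (h : Howe M N) (C : Ctx m n) :
    Howe (C.fill M) (C.fill N) := by
  induction C with
  | hole => exact h
  | lam C ih => exact .lam ih (.refl _)
  | appL C L ih => exact .app ih (refl L) (.refl _)
  | appR L C ih => exact .app (refl L) ih (.refl _)
  | choiceL C L ih => exact .choice ih (refl L) (.refl _)
  | choiceR L C ih => exact .choice (refl L) ih (.refl _)

theorem multiFill {k n : ℕ} {Ms Ns : Fin k → Tm 0} (h : ∀ i, ∀ s, obs (Ms i) s = obs (Ns i) s)
    (C : MCtx k n) : Howe (C.fill Ms) (C.fill Ns) := by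
  induction C with
  | hole i => exact of_obsEq (.weaken (h i) _)
  | var i => exact refl _
  | lam C ih => exact .lam ih (.refl _)
  | app C D ihC ihD => exact .app ihC ihD (.refl _)
  | choice C D ihC ihD => exact .choice ihC ihD (.refl _)

end Howe

theorem ObsEq.fill {m n : ℕ} {M N : Tm m} (h : ObsEq M N) (C : Ctx m n) :
    ObsEq (C.fill M) (C.fill N) :=
  ((Howe.of_obsEq h).fill C).obsEq ((Howe.of_obsEq h.symm).fill C)

theorem ObsEq.inst {M N : Tm 0} (h : ObsEq M N) (P : Tm 1) : ObsEq (P.inst M) (P.inst N) :=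
  ((Howe.refl P).inst (.of_obsEq h)).obsEq ((Howe.refl P).inst (.of_obsEq h.symm))

/-! ### Bisimilarity is observational equivalence -/

/-- The coupled relation of observational equivalence. -/
def obsRel : CoupledRel where
  fst M N := ∀ s, obs M s = obs N s
  snd E F := ∀ s, E.obs s = F.obs s
  fst_le_snd M N h s := by simpa using h s

theorem obsEq_of_star {M N : Tm 0} (h : Star obsRel.fst M N) : ObsEq M N := by
  obtain ⟨k, C, Ms, Ns, h, rfl, rfl⟩ := h
  exact (Howe.multiFill h C).obsEq (Howe.multiFill (fun i s => (h i s).symm) C)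

theorem obsRel_bullet {Z Y : FSVal} (h : obsRel.snd (.val Z) (.val Y)) {M N : Tm 0}
    (hMN : Star obsRel.fst M N) : obsRel.snd (.sum (Z.bullet M)) (.sum (Y.bullet N)) := by
  intro s
  rw [← FSTm.obs_val_cons, h (M :: s), FSTm.obs_val_cons]
  -- It remains to replace `M` by `N` in each summand of `Y • M`, which is congruence.
  refine tsum_congr fun i => ?_
  exact congrArg _ (ObsEq.closed_iff.1 ((obsEq_of_star hMN).inst (Y.body i)) s)

/-- Reduction preserves observations, so a step on one side is answered by no step on the other. -/
theorem obsRel_isBisim : obsRel.IsBisim where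
  step E F h D hD := ⟨F, .refl, fun s => by rw [← hD.obs_eq, h s]⟩
  val Z F h := by
    obtain ⟨Y, hY⟩ := exists_steps_val F
    have h' : obsRel.snd (.val Z) (.val Y) := fun s => by rw [h s, Steps.obs_eq hY]
    exact ⟨Y, hY, by simpa using h' [], fun M N => obsRel_bullet h'⟩
  step_symm E F h G hG := ⟨E, .refl, fun s => by rw [← hG.obs_eq, h s]⟩
  val_symm E Y h := by
    obtain ⟨Z, hZ⟩ := exists_steps_val E
    have h' : obsRel.snd (.val Z) (.val Y) := fun s => by rw [← h s, Steps.obs_eq hZ]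
    exact ⟨Z, hZ, by simpa using h' [], fun M N => obsRel_bullet h'⟩

theorem bisim₂_iff {E F : FSTm} : Bisim₂ E F ↔ ∀ s, E.obs s = F.obs s :=
  ⟨fun ⟨_, hR, h⟩ => hR.obs_eq h, fun h => ⟨obsRel, obsRel_isBisim, h⟩⟩

theorem bisim₁_iff {M N : Tm 0} : Bisim₁ M N ↔ ∀ s, obs M s = obs N s :=
  ⟨fun ⟨R, hR, h⟩ s => by simpa using hR.obs_eq (R.fst_le_snd _ _ h) s,
    fun h => ⟨obsRel, obsRel_isBisim, h⟩⟩

theorem openBisim₁_iff {n : ℕ} {M N : Tm n} : OpenBisim₁ M N ↔ ObsEq M N :=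
  forall_congr' fun _ => bisim₁_iff

theorem EvalCtx.obs_fill_congr (C : EvalCtx) {E F : FSTm} (h : ∀ s, E.obs s = F.obs s)
    (s : List (Tm 0)) : (C.fill E).obs s = (C.fill F).obs s := by
  induction C generalizing s with
  | hole => exact h s
  | app C M ih => exact ih (M :: s)

end CoupledLB

open CoupledLB
theorem corollaryc :
    (∀ M N : Tm 0, Bisim₁ M N →
      ∀ (m : ℕ) (C : Ctx m 0), Bisim₁ (C.fill M.weaken) (C.fill N.weaken)) ∧
    (∀ (m : ℕ) (M N : Tm m), OpenBisim₁ M N →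
      ∀ (n : ℕ) (C : Ctx m n), OpenBisim₁ (C.fill M) (C.fill N)) ∧
    (∀ E F : FSTm, Bisim₂ E F → ∀ C : EvalCtx, Bisim₂ (C.fill E) (C.fill F)) := by
  refine ⟨fun M N h m C => ?_, fun m M N h n C => ?_, fun E F h C => ?_⟩
  · exact bisim₁_iff.2 (ObsEq.closed_iff.1 ((ObsEq.weaken (bisim₁_iff.1 h) m).fill C))
  · exact openBisim₁_iff.2 ((openBisim₁_iff.1 h).fill C)
  · exact bisim₂_iff.2 (C.obs_fill_congr (bisim₂_iff.1 h))
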